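/- Let $p,q,r,s$ be prime numbers with $p\equiv q\equiv r\equiv 3 \pmod 4$ and $qrs\equiv 1\pmod 4$, and assume that $\left(\frac qs\right)=\left(\frac rs\right)=1$ does not hold, where $\left(\frac{\cdot}{\cdot}\right)$ denotes the Legendre symbol. Call a number field $K$ with ring of integers $\mathcal O_K$ a Pólya field if for every prime number $\ell$ and every integer $f\ge 1$ the product of all maximal ideals $\mathfrak m$ of $\mathcal O_K$ with $|\mathcal O_K/\mathfrak m|=\ell^f$ is a principal ideal (an empty product being $\mathcal O_K$). Suppose that $\left(\frac ps\right)\neq\left(\frac 2s\right)=-1$ and $\left(\frac{qr}{p}\right)=-1$. 1. If $\left(\frac{pr}{q}\right)=-1$, then $\mathbb Q(\sqrt p,\sqrt{qrs})$ is a Pólya field. 2. If $\left(\frac qs\right)=\left(\frac rs\right)=-1$, then $\mathbb Q(\sqrt p,\sqrt{qrs})$ is a Pólya field (without any condition on $\left(\frac{pr}{q}\right)$). -/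

import Mathlib

open scoped NumberField

noncomputable section

/-- Only finitely many maximal ideals of `𝓞 K` have a given absolute norm. -/
theorem finite_maximal_absNorm_eq (K : Type*) [Field K] [NumberField K] (n : ℕ) :
    {𝔪 : Ideal (𝓞 K) | 𝔪.IsMaximal ∧ Ideal.absNorm 𝔪 = n}.Finite :=
  (Ideal.finite_setOfPred_absNorm_eq n).subset fun _ h => h.2

/-- The Ostrowski ideal `Π_n(K)`: the product of all maximal ideals of `𝓞 K` of absolute norm `n`
(the unit ideal if there is none). -/
def ostrowskiIdeal (K : Type*) [Field K] [NumberField K] (n : ℕ) : Ideal (𝓞 K) :=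
  ∏ 𝔪 ∈ (finite_maximal_absNorm_eq K n).toFinset, 𝔪

/-- A number field is a Pólya field if all its Ostrowski ideals `Π_{ℓ^f}(K)`, for prime powers
`ℓ^f` with `f ≥ 1`, are principal. -/
def IsPolyaField (K : Type*) [Field K] [NumberField K] : Prop :=
  ∀ ℓ f : ℕ, ℓ.Prime → 1 ≤ f → (ostrowskiIdeal K (ℓ ^ f)).IsPrincipal

/-- The field `ℚ(√a, √b)`, as a subfield of `ℝ`. -/
def sqrtField (a b : ℕ) : IntermediateField ℚ ℝ :=
  IntermediateField.adjoin ℚ {√(a : ℝ), √(b : ℝ)}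

theorem isIntegral_sqrt_natCast (a : ℕ) : IsIntegral ℚ √(a : ℝ) := by
  refine IsIntegral.of_pow (R := ℚ) (n := 2) two_pos ?_
  rw [Real.sq_sqrt (Nat.cast_nonneg a)]
  simpa using isIntegral_algebraMap (R := ℚ) (A := ℝ) (x := (a : ℚ))

instance instNumberFieldSqrtField (a b : ℕ) : NumberField (sqrtField a b) where
  to_charZero := inferInstance
  to_finiteDimensional := by
    have : Finite ({√(a : ℝ), √(b : ℝ)} : Set ℝ) := by
      exact Set.Finite.to_subtype (Set.toFinite _)
    refine IntermediateField.finiteDimensional_adjoin (fun x hx => ?_)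
    rcases hx with rfl | rfl
    · exact isIntegral_sqrt_natCast a
    · exact isIntegral_sqrt_natCast b

end

/-! K = ℚ(√p, √(qrs)) is Galois over ℚ with ramification indices at most 2. Hence an Ostrowski ideal
at ℓ is either trivial or the product of all primes above ℓ, whose e-th power is (ℓ). It is
principal if e = 1, and if e = 2 it suffices that ℓ is a unit times a square
(`ostrowskiIdeal_isPrincipal`). Only 2, p, q, r, s can ramify, and p = (√p)².

The rest comes from Pell equations for the three quadratic subfields. For the fundamental solution
of x² - dy² = 1, splitting (x + 1)(x - 1) = dy² gives mn = d and ma² - nb² = c with c = 1 or 2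
(`exists_mul_sq_sub_mul_sq`), and (ma + b√d)² is then a unit times cm (`AssocSq.of_norm_eq`). Taking
d = p yields 2. Taking d = qrs yields one of q, r, qr, with Legendre symbol 1 at s. For d = pqrs the
hypotheses exclude c = 1 (`false_of_sign`), and after removal of 2 and p there remains one of q, r,
qr with symbol (2/s) = -1. The two outcomes differ, so together they generate q and r; then s
follows from qrs = (√(qrs))². -/

/-- The element `n` of `R` is, up to a unit, a square. -/
def AssocSq (R : Type*) [CommRing R] (n : ℤ) : Prop :=
  ∃ α : R, Associated (α ^ 2) (n : R)

/-! ### Squares up to units -/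

namespace AssocSq

variable {R : Type*} [CommRing R]

theorem mul {m n : ℤ} (hm : AssocSq R m) (hn : AssocSq R n) : AssocSq R (m * n) := by
  obtain ⟨α, hα⟩ := hm
  obtain ⟨β, hβ⟩ := hn
  exact ⟨α * β, by simpa [mul_pow] using hα.mul_mul hβ⟩

theorem neg {n : ℤ} (hn : AssocSq R n) : AssocSq R (-n) := by
  obtain ⟨α, hα⟩ := hn
  exact ⟨α, by simpa using hα.neg_right⟩

theorem of_mul_left [IsDomain R] [IsIntegrallyClosed R] [CharZero R] {m n : ℤ} (hm0 : m ≠ 0)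
    (hmn : AssocSq R (m * n)) (hm : AssocSq R m) : AssocSq R n := by
  obtain ⟨α, hα⟩ := hm
  obtain ⟨β, hβ⟩ := hmn
  have hdvd : α ^ 2 ∣ β ^ 2 := by
    rw [hα.dvd_iff_dvd_left, hβ.dvd_iff_dvd_right]
    simp
  rw [IsIntegrallyClosed.pow_dvd_pow_iff two_ne_zero] at hdvd
  obtain ⟨γ, rfl⟩ := hdvd
  refine ⟨γ, ?_⟩
  have h0 : (m : R) ≠ 0 := by exact_mod_cast hm0
  refine Associated.of_mul_left (a := α ^ 2) (c := m) ?_ hα (by rwa [Ne, hα.eq_zero_iff])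
  simpa [mul_pow] using hβ

theorem of_sq_eq {n : ℤ} {α : R} (h : α ^ 2 = n) : AssocSq R n :=
  ⟨α, by rw [h]⟩

/-- The element ma + bδ has norm m(ma² - nb²) = cm, and its quotient by its conjugate is the unit 1
+ k(nb² + abδ). The condition kc = 2 keeps this unit free of denominators. -/
theorem of_norm_eq {m n a b c k : ℤ} {δ : R} (hδ : δ ^ 2 = ((m * n : ℤ) : R))
    (h : m * a ^ 2 - n * b ^ 2 = c) (hkc : k * c = 2) : AssocSq R (c * m) := by
  have h' : (m : R) * a ^ 2 - n * b ^ 2 = c := by exact_mod_cast congrArg (Int.cast (R := R)) h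
  have hkc' : (k : R) * c = 2 := by exact_mod_cast congrArg (Int.cast (R := R)) hkc
  push_cast at hδ
  have hu : (1 + k * (n * b ^ 2 + a * b * δ) : R) * (1 + k * (n * b ^ 2 - a * b * δ)) = 1 := by
    linear_combination (-(k : R) ^ 2 * a ^ 2 * b ^ 2) * hδ - (k : R) ^ 2 * n * b ^ 2 * h' -
      (k : R) * n * b ^ 2 * hkc'
  refine ⟨m * a + b * δ, Associated.symm ⟨Units.mkOfMulEqOne _ _ hu, ?_⟩⟩
  push_cast
  simp only [Units.val_mkOfMulEqOne]
  linear_combination (-(b : R) ^ 2) * hδ - (m : R) * h' +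
    (m : R) * (n * b ^ 2 + a * b * δ) * hkc'

end AssocSq

/-! ### Splitting the Pell equation -/

theorem exists_sq_of_isCoprime_of_mul_eq {u v d y : ℤ} (hu : 0 < u) (hv : 0 < v) (hd : 0 < d)
    (huv : IsCoprime u v) (h : u * v = d * y ^ 2) :
    ∃ m n a b : ℤ, 0 < m ∧ 0 < n ∧ m * n = d ∧ u = m * a ^ 2 ∧ v = n * b ^ 2 := by
  obtain ⟨m, n, hm, hn, hmn⟩ := exists_dvd_and_dvd_of_dvd_mul (Dvd.intro _ h.symm : d ∣ u * v)
  wlog hm0 : 0 < m generalizing m n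
  · refine this (-m) (-n) (by simpa) (by simpa) (by linarith [neg_mul_neg m n]) ?_
    rcases lt_trichotomy m 0 with h | h | h
    · linarith
    · simp [h] at hmn; omega
    · exact absurd h hm0
  have hn0 : 0 < n := by rw [hmn] at hd; exact pos_of_mul_pos_right hd hm0.le
  obtain ⟨u', rfl⟩ := hm
  obtain ⟨v', rfl⟩ := hn
  have hu' : 0 < u' := pos_of_mul_pos_right hu hm0.le
  have hv' : 0 < v' := pos_of_mul_pos_right hv hn0.le
  have hcop : IsCoprime u' v' := huv.of_mul_left_right.of_mul_right_right
  have hsq : u' * v' = y ^ 2 := by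
    apply mul_left_cancel₀ hd.ne'
    rw [← h, hmn]; ring
  obtain ⟨a, ha⟩ := Int.sq_of_isCoprime hcop hsq
  obtain ⟨b, hb⟩ := Int.sq_of_isCoprime hcop.symm (by rw [mul_comm]; exact hsq)
  refine ⟨m, n, a, b, hm0, hn0, hmn.symm, ?_, ?_⟩
  · rcases ha with rfl | rfl
    · rfl
    · nlinarith [sq_nonneg a]
  · rcases hb with rfl | rfl
    · rfl
    · nlinarith [sq_nonneg b]

theorem exists_mul_sq_sub_mul_sq {d : ℤ} (hd : 0 < d) (hsq : ¬ IsSquare d) (h4 : ¬ 4 ∣ d) :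
    ∃ m n a b c : ℤ, 0 < m ∧ 0 < n ∧ m * n = d ∧ m * a ^ 2 - n * b ^ 2 = c ∧
      (c = 1 ∧ m ≠ 1 ∨ c = 2) := by
  obtain ⟨z, hz⟩ := Pell.IsFundamental.exists_of_not_isSquare hd hsq
  have hx := hz.1
  have hprop := z.prop
  rcases Int.even_or_odd' z.x with ⟨k, hk | hk⟩
  · have hcop : IsCoprime (z.x + 1) (z.x - 1) := ⟨1 - k, k, by rw [hk]; ring⟩
    obtain ⟨m, n, a, b, hm, hn, hmn, hu, hv⟩ :=
      exists_sq_of_isCoprime_of_mul_eq (y := z.y) (by linarith) (by linarith) hd hcop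
        (by linarith)
    exact ⟨m, n, a, b, 2, hm, hn, hmn, by linarith, Or.inr rfl⟩
  · have hy : Even z.y := by
      by_contra hy
      obtain ⟨y, hy⟩ := Int.not_even_iff_odd.1 hy
      apply h4
      rw [hk, hy] at hprop
      exact ⟨k ^ 2 + k - d * (y ^ 2 + y), by linarith⟩
    obtain ⟨y, hy⟩ := hy
    have hcop : IsCoprime (k + 1) k := ⟨1, -1, by ring⟩
    have hprod : (k + 1) * k = d * y ^ 2 := by
      rw [hk, hy] at hprop; linarith
    obtain ⟨m, n, a, b, hm, hn, hmn, hu, hv⟩ :=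
      exists_sq_of_isCoprime_of_mul_eq (y := y) (by omega) (by omega) hd hcop hprod
    refine ⟨m, n, a, b, 1, hm, hn, hmn, by linarith, Or.inl ⟨rfl, ?_⟩⟩
    -- If m = 1, then (|a|, b) solves the same Pell equation with x = 2a² - 1 > |a|, against
    -- minimality of the fundamental solution.
    rintro rfl
    rw [one_mul] at hmn hu
    subst hmn
    have hlt : 1 < |a| := by
      rw [← one_lt_sq_iff_one_lt_abs]; omega
    have hle := hz.x_le_x (a := Pell.Solution₁.mk |a| b (by rw [sq_abs]; linarith)) (by simpa)
    rw [Pell.Solution₁.x_mk] at hle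
    nlinarith [sq_abs a]

/-! ### Ostrowski ideals in Galois extensions -/

theorem isPrincipal_of_pow_eq_span {R : Type*} [CommRing R] [IsDedekindDomain R] {I : Ideal R}
    {n e : ℕ} (he0 : e ≠ 0) (he : e ≤ 2) (hI : I ^ e = Ideal.span {(n : R)})
    (h : e ≠ 1 → ∃ α : R, Associated (α ^ 2) (n : R)) : I.IsPrincipal := by
  by_cases h1 : e = 1
  · subst h1
    rw [pow_one] at hI
    exact ⟨n, hI⟩
  · obtain ⟨α, hα⟩ := h h1
    obtain rfl : e = 2 := by omega
    rw [← Ideal.span_singleton_eq_span_singleton.2 hα, ← Ideal.span_singleton_pow] at hI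
    exact ⟨α, pow_left_injective two_ne_zero hI⟩

section

variable {K : Type*} [Field K] [NumberField K]

theorem liesOver_span_of_absNorm_eq {ℓ f : ℕ} (hℓ : ℓ.Prime) {𝔪 : Ideal (𝓞 K)}
    [h𝔪 : 𝔪.IsMaximal] (h : Ideal.absNorm 𝔪 = ℓ ^ f) :
    𝔪.LiesOver (Ideal.span {(ℓ : ℤ)}) := by
  have hmem : ((ℓ : ℤ) : 𝓞 K) ∈ 𝔪 := by
    have := Ideal.absNorm_mem 𝔪
    rw [h] at this
    push_cast at this ⊢
    exact h𝔪.isPrime.mem_of_pow_mem _ this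
  have hmax : (Ideal.span {(ℓ : ℤ)}).IsMaximal :=
    ((Ideal.span_singleton_prime (by exact_mod_cast hℓ.ne_zero)).2
      (Nat.prime_iff_prime_int.1 hℓ)).isMaximal (by simpa using hℓ.ne_zero)
  refine ⟨hmax.eq_of_le (Ideal.IsPrime.ne_top inferInstance) ?_⟩
  rw [Ideal.span_singleton_le_iff_mem]
  simpa [Ideal.mem_comap] using hmem

theorem ostrowskiIdeal_isPrincipal [IsGalois ℚ K] {ℓ f : ℕ} (hℓ : ℓ.Prime)
    (hle : ∀ P : Ideal (𝓞 K), P.IsPrime → (ℓ : 𝓞 K) ∈ P → Nat.card (P.inertia Gal(K/ℚ)) ≤ 2)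
    (h : (∃ α : 𝓞 K, Associated (α ^ 2) (ℓ : 𝓞 K)) ∨
      ∀ P : Ideal (𝓞 K), P.IsPrime → (ℓ : 𝓞 K) ∈ P → Nat.card (P.inertia Gal(K/ℚ)) ≤ 1) :
    (ostrowskiIdeal K (ℓ ^ f)).IsPrincipal := by
  rcases Set.eq_empty_or_nonempty {𝔪 : Ideal (𝓞 K) | 𝔪.IsMaximal ∧ Ideal.absNorm 𝔪 = ℓ ^ f} with
    hemp | ⟨𝔪, h𝔪, hnorm⟩
  · simp only [ostrowskiIdeal, hemp, Set.toFinite_toFinset, Set.toFinset_empty, Finset.prod_empty]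
    exact ⟨1, by simp⟩
  have hprime : (Ideal.span {(ℓ : ℤ)}).IsPrime :=
    (Ideal.span_singleton_prime (by exact_mod_cast hℓ.ne_zero)).2 (Nat.prime_iff_prime_int.1 hℓ)
  have hbot : Ideal.span {(ℓ : ℤ)} ≠ ⊥ := by simpa using hℓ.ne_zero
  have hmax : (Ideal.span {(ℓ : ℤ)}).IsMaximal := hprime.isMaximal hbot
  have hover := liesOver_span_of_absNorm_eq hℓ hnorm
  -- All primes above ℓ are conjugate, so they share one residue degree: one of norm `ℓ ^ f` forces
  -- all to have it.
  have hset : {𝔫 : Ideal (𝓞 K) | 𝔫.IsMaximal ∧ Ideal.absNorm 𝔫 = ℓ ^ f} =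
      (Ideal.span {(ℓ : ℤ)}).primesOver (𝓞 K) := by
    ext 𝔫
    constructor
    · rintro ⟨h1, h2⟩
      exact ⟨h1.isPrime, liesOver_span_of_absNorm_eq hℓ h2⟩
    · rintro ⟨h1, h2⟩
      refine ⟨Ideal.IsMaximal.of_liesOver_isMaximal 𝔫 (Ideal.span {(ℓ : ℤ)}), ?_⟩
      rw [← hnorm, ← Ideal.pow_inertiaDeg ℓ 𝔪, ← Ideal.pow_inertiaDeg ℓ 𝔫,
        Ideal.inertiaDeg_eq_of_isGaloisGroup (Ideal.span {(ℓ : ℤ)}) 𝔪 𝔫 Gal(K/ℚ)]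
  have hmem : (ℓ : 𝓞 K) ∈ 𝔪 := by
    have := Ideal.absNorm_mem 𝔪
    rw [hnorm] at this
    push_cast at this
    exact h𝔪.isPrime.mem_of_pow_mem _ this
  have hprod := Ideal.map_algebraMap_eq_finsetProd_pow (R := 𝓞 K) hbot
  have : PerfectField (Ideal.span {(ℓ : ℤ)}).ResidueField := inferInstance
  have he := Ideal.card_inertia_eq_ramificationIdxIn (G := Gal(K/ℚ)) (Ideal.span {(ℓ : ℤ)}) 𝔪
  refine isPrincipal_of_pow_eq_span (n := ℓ) (e := Nat.card (𝔪.inertia Gal(K/ℚ)))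
    Nat.card_pos.ne' (hle 𝔪 h𝔪.isPrime hmem) ?_ ?_
  · rw [Ideal.map_span, Set.image_singleton] at hprod
    simp only [eq_intCast, Int.cast_natCast] at hprod
    rw [hprod, ostrowskiIdeal, ← Finset.prod_pow]
    refine Finset.prod_congr (by ext; simp [hset]) ?_
    intro P hP
    obtain ⟨_, _⟩ := Set.mem_toFinset.1 hP
    rw [he, Ideal.ramificationIdxIn_eq_ramificationIdx _ P Gal(K/ℚ)]
  · intro hne
    refine h.resolve_right fun h1 => hne ?_
    exact le_antisymm (h1 𝔪 h𝔪.isPrime hmem) Nat.card_pos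
end

/-! ### Local conditions on ma² - nb² = e -/

theorem legendreSym_eq_of_mul_sq_sub {ℓ : ℕ} [Fact ℓ.Prime] {m n a b e : ℤ}
    (h : m * a ^ 2 - n * b ^ 2 = e) (hn : (ℓ : ℤ) ∣ n) (he : ¬ (ℓ : ℤ) ∣ e) :
    legendreSym ℓ m = legendreSym ℓ e := by
  rw [← ZMod.intCast_zmod_eq_zero_iff_dvd] at hn he
  have h' := congrArg (Int.cast (R := ZMod ℓ)) h
  push_cast at h'
  rw [hn, zero_mul, sub_zero] at h'
  have ha : (a : ZMod ℓ) ≠ 0 := by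
    intro ha
    rw [ha] at h'
    exact he (by rw [← h']; ring)
  have : legendreSym ℓ (m * a ^ 2) = legendreSym ℓ e := by
    simp only [legendreSym]
    push_cast
    rw [h']
  rw [← this, legendreSym.mul, legendreSym.sq_one' ℓ ha, mul_one]

theorem legendreSym_neg_one_of_three_mod_four {ℓ : ℕ} [Fact ℓ.Prime] (hℓ : ℓ % 4 = 3) :
    legendreSym ℓ (-1) = -1 := by
  rw [legendreSym.at_neg_one (by omega), ZMod.χ₄_nat_three_mod_four hℓ]

theorem legendreSym_neg_one_of_one_mod_four {ℓ : ℕ} [Fact ℓ.Prime] (hℓ : ℓ % 4 = 1) :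
    legendreSym ℓ (-1) = 1 := by
  rw [legendreSym.at_neg_one (by omega), ZMod.χ₄_nat_one_mod_four hℓ]

theorem legendreSym_prime_eq_one_or_neg_one {ℓ k : ℕ} [Fact ℓ.Prime] [Fact k.Prime] (h : ℓ ≠ k) :
    legendreSym ℓ k = 1 ∨ legendreSym ℓ k = -1 := by
  apply legendreSym.eq_one_or_neg_one
  have := (ZMod.prime_ne_zero ℓ k h)
  exact_mod_cast this

theorem exists_of_mul_eq_prime_mul {p : ℕ} [hp : Fact p.Prime] {m n t : ℤ} (h : m * n = p * t) :
    (∃ k, m = p * k ∧ k * n = t) ∨ ∃ k, n = p * k ∧ m * k = t := by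
  have h0 : (p : ℤ) ≠ 0 := by exact_mod_cast hp.out.ne_zero
  rcases (Nat.prime_iff_prime_int.1 hp.out).dvd_or_dvd (Dvd.intro _ h.symm) with ⟨k, rfl⟩ | ⟨k, rfl⟩
  · exact Or.inl ⟨k, rfl, mul_left_cancel₀ h0 (by rw [← h]; ring)⟩
  · exact Or.inr ⟨k, rfl, mul_left_cancel₀ h0 (by rw [← h]; ring)⟩

/-- Modulo 4, n = -m, so e = m(a² + b²); as e is odd, a² + b² = 1. -/
theorem sign_eq_of_mul_sq_sub {m n a b e : ℤ} (h : m * a ^ 2 - n * b ^ 2 = e)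
    (hmn : (m * n : ZMod 4) = 3) (he : e = 1 ∨ e = -1) : (e : ZMod 4) = m := by
  have key : ∀ m n a b : ZMod 4, m * n = 3 →
      (m * a ^ 2 - n * b ^ 2 = 1 ∨ m * a ^ 2 - n * b ^ 2 = -1) → m * a ^ 2 - n * b ^ 2 = m := by
    decide
  have h' := congrArg (Int.cast (R := ZMod 4)) h
  push_cast at h'
  rw [← h']
  refine key _ _ _ _ hmn ?_
  rw [h']
  rcases he with rfl | rfl <;> simp

/-! ### Squares up to units from the quadratic subfields -/

section

variable {R : Type*} [CommRing R]

/-- The prime s is always placed in the second coefficient. If it divides the first one, the two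
terms are exchanged, which costs a sign in e. -/
theorem exists_assocSq_of_sq_eq {t : ℤ} {s : ℕ} [hs : Fact s.Prime] (ht : 0 < t) {δ : R}
    (hδ : δ ^ 2 = ((s * t : ℤ) : R)) (hsq : ¬ IsSquare (s * t : ℤ)) (h4 : ¬ 4 ∣ (s * t : ℤ)) :
    ∃ m n a b e : ℤ, 0 < m ∧ 0 < n ∧ m * n = t ∧ m * a ^ 2 - (s * n) * b ^ 2 = e ∧
      (e = 1 ∧ m ≠ 1 ∧ AssocSq R m ∨ e = -1 ∧ AssocSq R m ∨
        (e = 2 ∨ e = -2) ∧ AssocSq R (2 * m)) := by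
  have hs0 : (0 : ℤ) < s := by exact_mod_cast hs.out.pos
  obtain ⟨m, n, a, b, c, hm, hn, hmn, h, hc⟩ := exists_mul_sq_sub_mul_sq (mul_pos hs0 ht) hsq h4
  rcases exists_of_mul_eq_prime_mul hmn with ⟨k, rfl, hk⟩ | ⟨k, rfl, hk⟩
  · have h' : n * b ^ 2 - s * k * a ^ 2 = -c := by linarith
    have hδ' : δ ^ 2 = ((n * (s * k) : ℤ) : R) := by rw [hδ, ← hmn, mul_comm]
    refine ⟨n, k, b, a, -c, hn, pos_of_mul_pos_right hm hs0.le, by rw [mul_comm]; exact hk, h', ?_⟩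
    rcases hc with ⟨rfl, -⟩ | rfl
    · have := (AssocSq.of_norm_eq (k := -2) hδ' h' rfl).neg
      exact Or.inr (Or.inl ⟨rfl, by simpa using this⟩)
    · have := (AssocSq.of_norm_eq (k := -1) hδ' h' rfl).neg
      exact Or.inr (Or.inr ⟨Or.inr rfl, by simpa using this⟩)
  · have hδ' : δ ^ 2 = ((m * (s * k) : ℤ) : R) := by rw [hδ, ← hmn]
    refine ⟨m, k, a, b, c, hm, pos_of_mul_pos_right hn hs0.le, hk, h, ?_⟩
    rcases hc with ⟨rfl, h1⟩ | rfl
    · have := AssocSq.of_norm_eq (k := 2) hδ' h rfl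
      exact Or.inl ⟨rfl, h1, by simpa using this⟩
    · have := AssocSq.of_norm_eq (k := 1) hδ' h rfl
      exact Or.inr (Or.inr ⟨Or.inl rfl, this⟩)

theorem not_isSquare_of_cast_zmod_four_eq_three {d : ℤ} (hd : (d : ZMod 4) = 3) :
    ¬ IsSquare d := by
  rintro ⟨x, rfl⟩
  push_cast at hd
  revert hd
  generalize (x : ZMod 4) = y
  revert y
  decide

theorem not_four_dvd_of_cast_zmod_four_ne_zero {d : ℤ} (hd : (d : ZMod 4) ≠ 0) : ¬ 4 ∣ d := by
  intro h
  exact hd ((ZMod.intCast_zmod_eq_zero_iff_dvd d 4).2 (by exact_mod_cast h))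

theorem cast_zmod_four_eq_three {p : ℕ} (hp : p % 4 = 3) : (p : ZMod 4) = 3 := by
  rw [← ZMod.natCast_mod, hp]; rfl

theorem assocSq_two_of_sq_eq {p : ℕ} [Fact p.Prime] [IsDomain R] [IsIntegrallyClosed R]
    [CharZero R] (hp : p % 4 = 3) {δ : R} (hδ : δ ^ 2 = p) : AssocSq R 2 := by
  have hp' := cast_zmod_four_eq_three hp
  have hpR : AssocSq R p := ⟨δ, by rw [hδ]; simp⟩
  have hp0 : (p : ℤ) ≠ 0 := by omega
  obtain ⟨m, n, a, b, e, hm, hn, hmn, h, he⟩ :=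
    exists_assocSq_of_sq_eq (R := R) (s := p) (t := 1) one_pos (δ := δ) (by rw [hδ]; simp)
      (not_isSquare_of_cast_zmod_four_eq_three (by simp [hp']))
      (not_four_dvd_of_cast_zmod_four_ne_zero (by simp [hp']; decide))
  obtain rfl : m = 1 := Int.eq_one_of_mul_eq_one_right hm.le hmn
  obtain rfl : n = 1 := by simpa using hmn
  rcases he with ⟨-, h1, -⟩ | ⟨rfl, -⟩ | ⟨-, h2⟩
  · exact absurd rfl h1
  · have := sign_eq_of_mul_sq_sub h (by simp [hp']) (Or.inr rfl)
    exact absurd this (by decide)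
  · simpa using h2

end

theorem not_natCast_dvd_of_isUnit {ℓ : ℕ} [hℓ : Fact ℓ.Prime] {e : ℤ} (he : IsUnit e) :
    ¬ (ℓ : ℤ) ∣ e := fun h =>
  (Nat.prime_iff_prime_int.1 hℓ.out).not_isUnit (isUnit_of_dvd_unit h he)

theorem not_natCast_dvd_two {ℓ : ℕ} [hℓ : Fact ℓ.Prime] (h2 : ℓ ≠ 2) : ¬ (ℓ : ℤ) ∣ 2 := by
  intro h
  exact h2 ((Nat.prime_dvd_prime_iff_eq hℓ.out Nat.prime_two).1 (by exact_mod_cast h))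

section

variable {R : Type*} [CommRing R] {p q r s : ℕ} [Fact p.Prime] [Fact q.Prime] [Fact r.Prime]
  [Fact s.Prime]

theorem legendreSym_eq_one_of_sign (hs : s % 4 = 1) {m n a b e : ℤ}
    (h : m * a ^ 2 - (s * n) * b ^ 2 = e) (he : e = 1 ∨ e = -1) : legendreSym s m = 1 := by
  rw [legendreSym_eq_of_mul_sq_sub h (dvd_mul_right _ _)
    (not_natCast_dvd_of_isUnit (Int.isUnit_iff.2 he))]
  rcases he with rfl | rfl
  · exact legendreSym.at_one s
  · exact legendreSym_neg_one_of_one_mod_four hs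

theorem assocSq_of_sq_eq_mul_mul (hq : q % 4 = 3) (hr : r % 4 = 3) (hs : s % 4 = 1) {δ : R}
    (hδ : δ ^ 2 = ((s * (q * r) : ℤ) : R)) :
    (AssocSq R q ∧ legendreSym s q = 1) ∨ (AssocSq R r ∧ legendreSym s r = 1) ∨
      (AssocSq R (q * r) ∧ legendreSym s q * legendreSym s r = 1) := by
  have hq' := cast_zmod_four_eq_three hq
  have hr' := cast_zmod_four_eq_three hr
  have hs' : (s : ZMod 4) = 1 := by rw [← ZMod.natCast_mod, hs]; rfl
  have hq0 : (0 : ℤ) < q := by omega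
  have hr0 : (0 : ℤ) < r := by omega
  -- Since sqr ≡ 1 mod 4, reduction mod 4 does not help; instead s divides the product exactly once,
  -- as q and r are not 1 mod 4.
  have hsq : ¬ IsSquare (s * (q * r) : ℤ) := by
    rintro ⟨x, hx⟩
    have hsp := Nat.prime_iff_prime_int.1 (Fact.out : s.Prime)
    have hdvd : (s : ℤ) ∣ x := by
      rcases hsp.dvd_or_dvd (Dvd.intro _ hx) with h | h <;> exact h
    obtain ⟨y, rfl⟩ := hdvd
    have hdvd : s ∣ q * r := by
      have : (s : ℤ) ∣ q * r := ⟨y * y, mul_left_cancel₀ hsp.ne_zero (by rw [hx]; ring)⟩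
      exact_mod_cast this
    rcases (Nat.Prime.dvd_mul Fact.out).1 hdvd with h | h <;>
      rw [Nat.prime_dvd_prime_iff_eq Fact.out Fact.out] at h <;> omega
  obtain ⟨m, n, a, b, e, hm, hn, hmn, h, he⟩ :=
    exists_assocSq_of_sq_eq (mul_pos hq0 hr0) hδ hsq
      (not_four_dvd_of_cast_zmod_four_ne_zero (by push_cast; rw [hq', hr', hs']; decide))
  have he' : e = 1 ∨ e = -1 := by
    rcases he with ⟨h, -⟩ | ⟨h, -⟩ | ⟨he, -⟩
    · exact Or.inl h
    · exact Or.inr h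
    · exfalso
      -- Here m = n = ±1 mod 4, and a² - b² is never 2 mod 4.
      have key : ∀ m n a b : ZMod 4, m * n = 1 → ¬ m * a ^ 2 - n * b ^ 2 = 2 := by decide
      have h' := congrArg (Int.cast (R := ZMod 4)) h
      have hmn' := congrArg (Int.cast (R := ZMod 4)) hmn
      push_cast at h' hmn'
      rw [hq', hr'] at hmn'
      rw [hs', one_mul] at h'
      refine key _ _ _ _ (hmn'.trans (by decide)) (h'.trans ?_)
      rcases he with rfl | rfl <;> decide
  have hA : AssocSq R m ∧ (e = 1 → m ≠ 1) := by
    rcases he with ⟨-, h1, h2⟩ | ⟨h1, h2⟩ | ⟨h1, -⟩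
    · exact ⟨h2, fun _ => h1⟩
    · exact ⟨h2, fun h3 => by omega⟩
    · omega
  have hleg := legendreSym_eq_one_of_sign hs h he'
  rcases exists_of_mul_eq_prime_mul hmn with ⟨m, rfl, hmn₁⟩ | ⟨n, rfl, hmn₁⟩ <;>
  rcases exists_of_mul_eq_prime_mul (hmn₁.trans (mul_one _).symm) with
    ⟨m, rfl, hmn₂⟩ | ⟨n, rfl, hmn₂⟩
  · obtain rfl : m = 1 := Int.eq_one_of_mul_eq_one_right
      (pos_of_mul_pos_right (pos_of_mul_pos_right hm hq0.le) hr0.le).le hmn₂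
    rw [mul_one] at hA hleg
    exact Or.inr (Or.inr ⟨hA.1, by rwa [← legendreSym.mul]⟩)
  · obtain rfl : m = 1 := Int.eq_one_of_mul_eq_one_right (pos_of_mul_pos_right hm hq0.le).le hmn₂
    rw [mul_one] at hA hleg
    exact Or.inl ⟨hA.1, hleg⟩
  · obtain rfl : m = 1 := Int.eq_one_of_mul_eq_one_right (pos_of_mul_pos_right hm hr0.le).le hmn₂
    rw [mul_one] at hA hleg
    exact Or.inr (Or.inl ⟨hA.1, hleg⟩)
  · obtain rfl : m = 1 := Int.eq_one_of_mul_eq_one_right hm.le hmn₂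
    rcases he' with rfl | rfl
    · exact absurd rfl (hA.2 rfl)
    -- The case m = 1, e = -1 would make -1 a square modulo q.
    · have := legendreSym_eq_of_mul_sq_sub (ℓ := q) h
        ((dvd_mul_right _ _).mul_left _) (not_natCast_dvd_of_isUnit (by simp))
      rw [legendreSym.at_one, legendreSym_neg_one_of_three_mod_four hq] at this
      omega

end

section

variable {R : Type*} [CommRing R] [IsDomain R] [IsIntegrallyClosed R] [CharZero R]
  {p q r s : ℕ} [Fact p.Prime] [Fact q.Prime] [Fact r.Prime] [Fact s.Prime]

theorem legendreSym_three_mod_four_swap (hp : p % 4 = 3) (hq : q % 4 = 3) :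
    legendreSym q p = - legendreSym p q :=
  legendreSym.quadratic_reciprocity_three_mod_four hp hq

/-- For each of the eight divisors m of pqr, e is fixed by m mod 4. Reduction modulo s gives (m/s) =
1, and reduction modulo p or q then contradicts the hypotheses. -/
theorem false_of_sign (hp : p % 4 = 3) (hq : q % 4 = 3) (hr : r % 4 = 3) (hs : s % 4 = 1)
    (hsp : legendreSym p s = 1) (hpqr : legendreSym p q * legendreSym p r = -1)
    (hcase : (legendreSym q p * legendreSym q r = -1 ∧
        ¬ (legendreSym q s = 1 ∧ legendreSym s r = 1)) ∨
      (legendreSym q s = -1 ∧ legendreSym s r = -1))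
    (hqs : legendreSym s q = legendreSym q s) (hps : legendreSym s p = 1)
    {m n a b e : ℤ} (hm : 0 < m) (hmn : m * n = p * (q * r))
    (h : m * a ^ 2 - (s * n) * b ^ 2 = e) (he : e = 1 ∨ e = -1) (hne : e = 1 → m ≠ 1) :
    False := by
  have hp' := cast_zmod_four_eq_three hp
  have hq' := cast_zmod_four_eq_three hq
  have hr' := cast_zmod_four_eq_three hr
  have hs' : (s : ZMod 4) = 1 := by rw [← ZMod.natCast_mod, hs]; rfl
  have hp0 : (0 : ℤ) < p := by omega
  have hq0 : (0 : ℤ) < q := by omega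
  have hr0 : (0 : ℤ) < r := by omega
  have hsm := legendreSym_eq_one_of_sign hs h he
  have hsign := sign_eq_of_mul_sq_sub h (by
    have hmn' := congrArg (Int.cast (R := ZMod 4)) hmn
    push_cast at hmn' ⊢
    rw [hs', one_mul, hmn', hp', hq', hr']
    decide) he
  have hunit : IsUnit e := Int.isUnit_iff.2 he
  have hdvd_right : ∀ {ℓ : ℕ} [Fact ℓ.Prime], (ℓ : ℤ) ∣ n → legendreSym ℓ m = legendreSym ℓ e :=
    fun hℓ => legendreSym_eq_of_mul_sq_sub h (hℓ.mul_left _) (not_natCast_dvd_of_isUnit hunit)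
  have hdvd_left : ∀ {ℓ : ℕ} [Fact ℓ.Prime], (ℓ : ℤ) ∣ m →
      legendreSym ℓ (s * n) = legendreSym ℓ (-e) := fun hℓ =>
    legendreSym_eq_of_mul_sq_sub (n := m) (a := b) (b := a) (by linarith) hℓ
      (not_natCast_dvd_of_isUnit hunit.neg)
  have hnp := legendreSym_neg_one_of_three_mod_four hp
  have hnq := legendreSym_neg_one_of_three_mod_four hq
  have hswap := legendreSym_three_mod_four_swap hp hq
  rcases exists_of_mul_eq_prime_mul hmn with ⟨m, rfl, hmn₁⟩ | ⟨n, rfl, hmn₁⟩ <;>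
  rcases exists_of_mul_eq_prime_mul hmn₁ with ⟨m, rfl, hmn₂⟩ | ⟨n, rfl, hmn₂⟩ <;>
  rcases exists_of_mul_eq_prime_mul (hmn₂.trans (mul_one _).symm) with
    ⟨m, rfl, hmn₃⟩ | ⟨n, rfl, hmn₃⟩ <;>
  obtain rfl : m = 1 := Int.eq_one_of_mul_eq_one_right
    (le_of_lt (by simpa only [mul_pos_iff_of_pos_left, hp0, hq0, hr0] using hm)) hmn₃ <;>
  obtain rfl : n = 1 := (one_mul n).symm.trans hmn₃ <;>
  push_cast at hsign <;>
  simp only [mul_one, legendreSym.mul, hp', hq', hr'] at *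
  -- m = pqr
  · obtain rfl : e = -1 := he.resolve_left (by rintro rfl; exact absurd hsign (by decide))
    have h1 := hdvd_left (ℓ := q) ⟨p * r, by ring⟩
    rw [neg_neg, legendreSym.at_one] at h1
    rw [h1] at hcase hqs
    grind
  -- m = pq
  · obtain rfl : e = 1 := he.resolve_right (by rintro rfl; exact absurd hsign (by decide))
    -- Now (q/s) = 1 leaves only the first alternative of `hcase`. Then (r/q) = (r/p) = -1, so (p/q)
    -- = (q/p) = 1, against reciprocity. The case m = r ends the same way.
    have h1 := hdvd_left (ℓ := q) ⟨p, by ring⟩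
    have h2 := hdvd_left (ℓ := p) ⟨q, by ring⟩
    grind
  -- m = pr
  · obtain rfl : e = 1 := he.resolve_right (by rintro rfl; exact absurd hsign (by decide))
    have h1 := hdvd_right (ℓ := q) ⟨1, by ring⟩
    rw [legendreSym.at_one] at h1
    grind
  -- m = p
  · obtain rfl : e = -1 := he.resolve_left (by rintro rfl; exact absurd hsign (by decide))
    have h1 := hdvd_left (ℓ := p) ⟨1, by ring⟩
    rw [neg_neg, legendreSym.at_one] at h1
    grind
  -- m = qr
  · obtain rfl : e = 1 := he.resolve_right (by rintro rfl; exact absurd hsign (by decide))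
    have h1 := hdvd_right (ℓ := p) ⟨1, by ring⟩
    rw [legendreSym.at_one] at h1
    grind
  -- m = q
  · obtain rfl : e = -1 := he.resolve_left (by rintro rfl; exact absurd hsign (by decide))
    have h1 := hdvd_left (ℓ := q) ⟨1, by ring⟩
    rw [neg_neg, legendreSym.at_one] at h1
    grind
  -- m = r
  · obtain rfl : e = -1 := he.resolve_left (by rintro rfl; exact absurd hsign (by decide))
    have h1 := hdvd_right (ℓ := q) ⟨p, by ring⟩
    have h2 := hdvd_right (ℓ := p) ⟨q, by ring⟩
    grind
  -- m = 1
  · exact hne (he.resolve_right (by rintro rfl; exact absurd hsign (by decide))) rfl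

theorem assocSq_of_sq_eq_mul_mul_mul (hp : p % 4 = 3) (hq : q % 4 = 3) (hr : r % 4 = 3)
    (hs : s % 4 = 1)
    (hsp : legendreSym p s = 1) (hpqr : legendreSym p q * legendreSym p r = -1)
    (hcase : (legendreSym q p * legendreSym q r = -1 ∧
        ¬ (legendreSym q s = 1 ∧ legendreSym s r = 1)) ∨
      (legendreSym q s = -1 ∧ legendreSym s r = -1))
    (hqs : legendreSym s q = legendreSym q s) (hps : legendreSym s p = 1)
    (h2s : legendreSym s 2 = -1) (hp2 : AssocSq R 2) (hpp : AssocSq R p) {δ : R}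
    (hδ : δ ^ 2 = ((s * (p * (q * r)) : ℤ) : R)) :
    (AssocSq R q ∧ legendreSym s q = -1) ∨ (AssocSq R r ∧ legendreSym s r = -1) ∨
      (AssocSq R (q * r) ∧ legendreSym s q * legendreSym s r = -1) := by
  have hp' := cast_zmod_four_eq_three hp
  have hq' := cast_zmod_four_eq_three hq
  have hr' := cast_zmod_four_eq_three hr
  have hs' : (s : ZMod 4) = 1 := by rw [← ZMod.natCast_mod, hs]; rfl
  have hp0 : (0 : ℤ) < p := by omega
  have hq0 : (0 : ℤ) < q := by omega
  have hr0 : (0 : ℤ) < r := by omega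
  have hd : ((s * (p * (q * r)) : ℤ) : ZMod 4) = 3 := by
    push_cast
    rw [hp', hq', hr', hs']
    decide
  obtain ⟨m, n, a, b, e, hm, hn, hmn, h, he⟩ :=
    exists_assocSq_of_sq_eq (mul_pos hp0 (mul_pos hq0 hr0)) hδ
      (not_isSquare_of_cast_zmod_four_eq_three hd)
      (not_four_dvd_of_cast_zmod_four_ne_zero (by rw [hd]; decide))
  have hfalse := false_of_sign hp hq hr hs hsp hpqr hcase hqs hps hm hmn h
  have he' : e = 2 ∨ e = -2 := by grind
  have hA : AssocSq R m := by
    rcases he with ⟨h, -⟩ | ⟨h, -⟩ | ⟨-, h⟩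
    · omega
    · omega
    · exact h.of_mul_left two_ne_zero hp2
  have hsm : legendreSym s m = -1 := by
    have h2 : ¬ (s : ℤ) ∣ 2 := not_natCast_dvd_two (by omega)
    rw [legendreSym_eq_of_mul_sq_sub h (dvd_mul_right _ _) (by
      rcases he' with rfl | rfl
      · exact h2
      · rwa [dvd_neg])]
    rcases he' with rfl | rfl
    · exact h2s
    · rw [← neg_one_mul, legendreSym.mul, h2s, legendreSym_neg_one_of_one_mod_four hs, one_mul]
  have hcancel : ∀ k : ℤ, AssocSq R (p * k) → AssocSq R k := fun k hk =>
    hk.of_mul_left hp0.ne' hpp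
  rcases exists_of_mul_eq_prime_mul hmn with ⟨m, rfl, hmn₁⟩ | ⟨n, rfl, hmn₁⟩ <;>
  rcases exists_of_mul_eq_prime_mul hmn₁ with ⟨m, rfl, hmn₂⟩ | ⟨n, rfl, hmn₂⟩ <;>
  rcases exists_of_mul_eq_prime_mul (hmn₂.trans (mul_one _).symm) with
    ⟨m, rfl, hmn₃⟩ | ⟨n, rfl, hmn₃⟩ <;>
  obtain rfl : m = 1 := Int.eq_one_of_mul_eq_one_right
    (le_of_lt (by simpa only [mul_pos_iff_of_pos_left, hp0, hq0, hr0] using hm)) hmn₃ <;>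
  simp only [mul_one, legendreSym.mul, legendreSym.at_one, hps, one_mul] at hA hsm <;>
  grind

/-- With `√p, √(qrs) ∈ R`, the primes `2`, `q`, `r` and `s` are squares up to units in `R`. -/
theorem assocSq_two_and_primes (hp : p % 4 = 3) (hq : q % 4 = 3) (hr : r % 4 = 3)
    (hs : s % 4 = 1) (hs1 : ¬ (legendreSym s q = 1 ∧ legendreSym s r = 1))
    (hps : legendreSym s p = 1) (h2s : legendreSym s 2 = -1)
    (hqrp : legendreSym p (q * r) = -1)
    (hcase : legendreSym q (p * r) = -1 ∨ (legendreSym s q = -1 ∧ legendreSym s r = -1))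
    {x y : R} (hx : x ^ 2 = p) (hy : y ^ 2 = (q * r * s : ℕ)) :
    AssocSq R 2 ∧ AssocSq R q ∧ AssocSq R r ∧ AssocSq R s := by
  have h2 := assocSq_two_of_sq_eq hp hx
  have hpp : AssocSq R p := ⟨x, by rw [hx]; simp⟩
  have hqs : legendreSym s q = legendreSym q s :=
    legendreSym.quadratic_reciprocity_one_mod_four hs (by omega) |>.symm
  have hsp : legendreSym p s = 1 := by
    rw [legendreSym.quadratic_reciprocity_one_mod_four hs (by omega)]
    exact hps
  simp only [legendreSym.mul] at hqrp hcase
  have hsq := legendreSym_prime_eq_one_or_neg_one (show s ≠ q by omega)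
  have hsr := legendreSym_prime_eq_one_or_neg_one (show s ≠ r by omega)
  have hB := assocSq_of_sq_eq_mul_mul (R := R) (δ := y) hq hr hs (by rw [hy]; push_cast; ring)
  have hC := assocSq_of_sq_eq_mul_mul_mul (R := R) (δ := x * y) hp hq hr hs hsp hqrp
    (by grind) hqs hps h2s h2 hpp (by rw [mul_pow, hx, hy]; push_cast; ring)
  have hqrs : AssocSq R (q * r * s) := AssocSq.of_sq_eq (α := y) (by rw [hy]; push_cast; ring)
  have hq0 : (q : ℤ) ≠ 0 := by omega
  have hr0 : (r : ℤ) ≠ 0 := by omega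
  have h_r : AssocSq R (q * r) → AssocSq R q → AssocSq R r := fun h h' => h.of_mul_left hq0 h'
  have h_q : AssocSq R (q * r) → AssocSq R r → AssocSq R q := fun h h' =>
    AssocSq.of_mul_left hr0 (by rwa [mul_comm]) h'
  -- `hB` and `hC` give elements of {q, r, qr} with opposite symbols at s, hence distinct; any two
  -- of the three yield q and r.
  have hqr : AssocSq R q ∧ AssocSq R r := by
    rcases hsq with h1 | h1 <;> rcases hsr with h3 | h3 <;>
      grind
  exact ⟨h2, hqr.1, hqr.2, hqrs.of_mul_left (mul_ne_zero hq0 hr0) (hqr.1.mul hqr.2)⟩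

end

/-! ### Action of inertia on square roots -/

section

variable {K : Type*} [Field K] [NumberField K]

theorem smul_eq_self_or_neg {x : 𝓞 K} {n : ℕ} (hx : x ^ 2 = n) (σ : Gal(K/ℚ)) :
    σ • x = x ∨ σ • x = -x := by
  rw [← sq_eq_sq_iff_eq_or_eq_neg, ← smul_pow', hx]
  exact map_natCast (MulSemiringAction.toRingHom Gal(K/ℚ) (𝓞 K) σ) n

theorem natCast_dvd_of_mem {R : Type*} [CommRing R] {P : Ideal R} [hP : P.IsPrime] {ℓ n : ℕ}
    (hℓ : ℓ.Prime) (hℓP : (ℓ : R) ∈ P) (hn : (n : R) ∈ P) : ℓ ∣ n := by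
  by_contra h
  have hcop : IsCoprime (ℓ : ℤ) n := Nat.isCoprime_iff_coprime.2 ((hℓ.coprime_iff_not_dvd).2 h)
  obtain ⟨u, v, huv⟩ := hcop
  refine hP.ne_top ((Ideal.eq_top_iff_one P).2 ?_)
  have h1 := congrArg (Int.cast (R := R)) huv
  push_cast at h1
  rw [← h1]
  exact P.add_mem (P.mul_mem_left _ hℓP) (P.mul_mem_left _ hn)

theorem smul_eq_self_of_mem_inertia {P : Ideal (𝓞 K)} [hP : P.IsPrime] {ℓ n : ℕ}
    (hℓ : ℓ.Prime) (hℓP : (ℓ : 𝓞 K) ∈ P) (h : ¬ ℓ ∣ 2 * n) {x : 𝓞 K} (hx : x ^ 2 = n)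
    {σ : Gal(K/ℚ)} (hσ : σ ∈ P.inertia Gal(K/ℚ)) : σ • x = x := by
  refine (smul_eq_self_or_neg hx σ).resolve_right fun hneg => h ?_
  have h1 : σ • x - x ∈ P := hσ x
  have h2 : ((2 * n : ℕ) : 𝓞 K) ∈ P := by
    have := P.mul_mem_left (-x) h1
    rw [hneg] at this
    convert this using 1
    push_cast
    rw [← hx]
    ring
  exact natCast_dvd_of_mem hℓ hℓP h2

theorem exists_two_mul_eq_one_add {n : ℕ} (hn : n % 4 = 1) {x : 𝓞 K} (hx : x ^ 2 = n) :
    ∃ ω : 𝓞 K, 2 * ω = 1 + x := by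
  have hx' : (x : K) ^ 2 = n := by exact_mod_cast congrArg (algebraMap (𝓞 K) K) hx
  obtain ⟨k, rfl⟩ : ∃ k, n = 4 * k + 1 := ⟨n / 4, by omega⟩
  have hint : IsIntegral ℤ ((1 + (x : K)) / 2) := by
    refine ⟨Polynomial.X ^ 2 - Polynomial.X - Polynomial.C (k : ℤ), ?_, ?_⟩
    · rw [sub_sub]
      apply Polynomial.monic_X_pow_sub
      rw [Polynomial.degree_X_add_C]
      norm_num
    · simp only [Polynomial.eval₂_sub, Polynomial.eval₂_pow, Polynomial.eval₂_X,
        map_natCast, Polynomial.eval₂_natCast]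
      push_cast at hx' ⊢
      linear_combination hx' / 4
  refine ⟨⟨_, hint⟩, ?_⟩
  apply NumberField.RingOfIntegers.ext
  change 2 * ((1 + (x : K)) / 2) = 1 + x
  ring

/-- Testing inertia on (1 + x)/2 instead of x removes the factor 2, so that ℓ = 2 is covered. -/
theorem smul_eq_self_of_mem_inertia_of_one_mod_four {P : Ideal (𝓞 K)} [hP : P.IsPrime]
    {ℓ n : ℕ} (hℓ : ℓ.Prime) (hℓP : (ℓ : 𝓞 K) ∈ P) (hn : n % 4 = 1) (h : ¬ ℓ ∣ n) {x : 𝓞 K}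
    (hx : x ^ 2 = n) {σ : Gal(K/ℚ)} (hσ : σ ∈ P.inertia Gal(K/ℚ)) : σ • x = x := by
  refine (smul_eq_self_or_neg hx σ).resolve_right fun hneg => h ?_
  obtain ⟨ω, hω⟩ := exists_two_mul_eq_one_add hn hx
  have h1 : σ • ω - ω ∈ P := hσ ω
  have h3 : σ • ω - ω = -x := by
    have h2 : 2 * (σ • ω) = 1 - x := by
      have := congrArg (σ • ·) hω
      simp only [smul_mul', smul_add, smul_one, hneg] at this
      rw [sub_eq_add_neg, ← this]
      congr 1
      exact (map_ofNat (MulSemiringAction.toRingHom Gal(K/ℚ) (𝓞 K) σ) 2).symm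
    apply mul_left_cancel₀ (two_ne_zero (α := 𝓞 K))
    linear_combination h2 - hω
  have h2 : (n : 𝓞 K) ∈ P := by
    have := P.mul_mem_left (-x) h1
    rw [h3] at this
    convert this using 1
    rw [← hx]
    ring
  exact natCast_dvd_of_mem hℓ hℓP h2

end

/-! ### The biquadratic field -/

section sqrtField

variable (a b : ℕ)

theorem sqrt_mem_sqrtField_left : √(a : ℝ) ∈ sqrtField a b :=
  IntermediateField.subset_adjoin _ _ (by simp)

theorem sqrt_mem_sqrtField_right : √(b : ℝ) ∈ sqrtField a b :=
  IntermediateField.subset_adjoin _ _ (by simp)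

open Polynomial in
instance isGalois_sqrtField : IsGalois ℚ (sqrtField a b) := by
  have hsplit : (((X ^ 2 - C (a : ℚ)) * (X ^ 2 - C (b : ℚ))).map (algebraMap ℚ ℝ)) =
      ((X - C √(a : ℝ)) * (X - C (-√(a : ℝ)))) * ((X - C √(b : ℝ)) * (X - C (-√(b : ℝ)))) := by
    have ha := Real.sq_sqrt (Nat.cast_nonneg (α := ℝ) a)
    have hb := Real.sq_sqrt (Nat.cast_nonneg (α := ℝ) b)
    have ha' : (C (a : ℝ)) = C √(a : ℝ) ^ 2 := by rw [← C_pow, ha]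
    have hb' : (C (b : ℝ)) = C √(b : ℝ) ^ 2 := by rw [← C_pow, hb]
    rw [Polynomial.map_mul, Polynomial.map_sub, Polynomial.map_sub, Polynomial.map_pow, map_X,
      map_C, map_C, map_natCast (algebraMap ℚ ℝ), map_natCast (algebraMap ℚ ℝ), ha', hb',
      C_neg, C_neg]
    ring
  have hs : (((X ^ 2 - C (a : ℚ)) * (X ^ 2 - C (b : ℚ))).map (algebraMap ℚ ℝ)).Splits := by
    rw [hsplit]
    exact ((Splits.X_sub_C _).mul (Splits.X_sub_C _)).mul
      ((Splits.X_sub_C _).mul (Splits.X_sub_C _))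
  have hmem : ∀ c : ℝ, c ∈ ((X ^ 2 - C (a : ℚ)) * (X ^ 2 - C (b : ℚ))).rootSet ℝ ↔
      (c = √(a : ℝ) ∨ c = -√(a : ℝ)) ∨ (c = √(b : ℝ) ∨ c = -√(b : ℝ)) := by
    intro c
    rw [mem_rootSet_of_ne (mul_ne_zero (X_pow_sub_C_ne_zero two_pos _)
      (X_pow_sub_C_ne_zero two_pos _)), aeval_def, ← eval_map, hsplit]
    simp [sub_eq_zero, add_eq_zero_iff_eq_neg]
  have hfield : ((X ^ 2 - C (a : ℚ)) * (X ^ 2 - C (b : ℚ))).IsSplittingField ℚ (sqrtField a b) := by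
    have h : sqrtField a b = IntermediateField.adjoin ℚ
        (((X ^ 2 - C (a : ℚ)) * (X ^ 2 - C (b : ℚ))).rootSet ℝ) := by
      apply le_antisymm
      · refine IntermediateField.adjoin.mono _ _ _ ?_
        rintro c (rfl | rfl)
        · exact (hmem _).2 (Or.inl (Or.inl rfl))
        · exact (hmem _).2 (Or.inr (Or.inl rfl))
      · rw [IntermediateField.adjoin_le_iff]
        intro c hc
        rcases (hmem c).1 hc with (rfl | rfl) | (rfl | rfl)
        · exact sqrt_mem_sqrtField_left a b
        · exact neg_mem (sqrt_mem_sqrtField_left a b)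
        · exact sqrt_mem_sqrtField_right a b
        · exact neg_mem (sqrt_mem_sqrtField_right a b)
    rw [h]
    exact IntermediateField.adjoin_rootSet_isSplittingField hs
  have := Normal.of_isSplittingField (F := ℚ) (E := sqrtField a b)
    ((X ^ 2 - C (a : ℚ)) * (X ^ 2 - C (b : ℚ)))
  exact {}

variable {a b}

theorem exists_integer_eq_sqrt {n : ℕ} (h : √(n : ℝ) ∈ sqrtField a b) :
    ∃ x : 𝓞 (sqrtField a b), ((x : sqrtField a b) : ℝ) = √(n : ℝ) ∧ x ^ 2 = n := by
  have hsq : (⟨√(n : ℝ), h⟩ : sqrtField a b) ^ 2 = n := by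
    apply Subtype.ext
    push_cast
    exact Real.sq_sqrt n.cast_nonneg
  have hint : IsIntegral ℤ (⟨√(n : ℝ), h⟩ : sqrtField a b) := by
    refine IsIntegral.of_pow (n := 2) two_pos ?_
    rw [hsq]
    exact isIntegral_algebraMap (R := ℤ) (x := (n : ℤ))
  exact ⟨⟨_, hint⟩, rfl, NumberField.RingOfIntegers.ext (by push_cast; exact hsq)⟩

theorem gal_eq_of_smul_eq {σ τ : Gal(sqrtField a b/ℚ)} {x y : 𝓞 (sqrtField a b)}
    (hx : ((x : sqrtField a b) : ℝ) = √(a : ℝ)) (hy : ((y : sqrtField a b) : ℝ) = √(b : ℝ))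
    (h1 : σ • x = τ • x) (h2 : σ • y = τ • y) : σ = τ := by
  have hx' : (x : sqrtField a b) = ⟨√(a : ℝ), sqrt_mem_sqrtField_left a b⟩ := Subtype.ext hx
  have hy' : (y : sqrtField a b) = ⟨√(b : ℝ), sqrt_mem_sqrtField_right a b⟩ := Subtype.ext hy
  have h1' : σ (x : sqrtField a b) = τ x := congrArg (algebraMap _ (sqrtField a b)) h1
  have h2' : σ (y : sqrtField a b) = τ y := congrArg (algebraMap _ (sqrtField a b)) h2
  rw [hx'] at h1'
  rw [hy'] at h2'
  apply AlgEquiv.coe_toAlgHom_injective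
  apply IntermediateField.adjoin_algHom_ext
  rintro z (rfl | rfl)
  · exact h1'
  · exact h2'

theorem card_inertia_le_two {p d : ℕ} (hd : d % 4 = 1) (hcop : (2 * p).Coprime d)
    {ℓ : ℕ} (hℓ : ℓ.Prime) (P : Ideal (𝓞 (sqrtField p d))) [P.IsPrime]
    (hP : (ℓ : 𝓞 (sqrtField p d)) ∈ P) : Nat.card (P.inertia Gal(sqrtField p d/ℚ)) ≤ 2 := by
  obtain ⟨x, hx, hx2⟩ := exists_integer_eq_sqrt (sqrt_mem_sqrtField_left p d)
  obtain ⟨y, hy, hy2⟩ := exists_integer_eq_sqrt (sqrt_mem_sqrtField_right p d)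
  have key : ∀ (z w : 𝓞 (sqrtField p d)) (n : ℕ), w ^ 2 = n →
      (∀ σ τ : Gal(sqrtField p d/ℚ), σ • z = τ • z → σ • w = τ • w → σ = τ) →
      (∀ σ ∈ P.inertia Gal(sqrtField p d/ℚ), σ • z = z) →
      Nat.card (P.inertia Gal(sqrtField p d/ℚ)) ≤ 2 := by
    intro z w n hw hext hz
    -- Once z is fixed, σ is determined by the truth value of σw = w, and `Prop` has two elements.
    have hinj : Function.Injective
        (fun σ : P.inertia Gal(sqrtField p d/ℚ) => (σ : Gal(sqrtField p d/ℚ)) • w = w) := by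
      rintro ⟨σ, hσ⟩ ⟨τ, hτ⟩ h
      refine Subtype.ext (hext σ τ (by rw [hz σ hσ, hz τ hτ]) ?_)
      simp only [eq_iff_iff] at h
      by_cases hw' : σ • w = w
      · rw [hw', h.1 hw']
      · rw [(smul_eq_self_or_neg hw σ).resolve_left hw',
          (smul_eq_self_or_neg hw τ).resolve_left fun h' => hw' (h.2 h')]
    simpa using Nat.card_le_card_of_injective _ hinj
  by_cases hdvd : ℓ ∣ d
  · have h2p : ¬ ℓ ∣ 2 * p := fun h => hℓ.one_lt.ne' (Nat.eq_one_of_dvd_coprimes hcop h hdvd)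
    exact key x y d hy2 (fun σ τ h1 h2 => gal_eq_of_smul_eq hx hy h1 h2)
      fun σ hσ => smul_eq_self_of_mem_inertia hℓ hP h2p hx2 hσ
  · exact key y x p hx2 (fun σ τ h1 h2 => gal_eq_of_smul_eq hx hy h2 h1)
      fun σ hσ => smul_eq_self_of_mem_inertia_of_one_mod_four hℓ hP hd hdvd hy2 hσ

theorem card_inertia_le_one {p d : ℕ} (hd : d % 4 = 1) {ℓ : ℕ} (hℓ : ℓ.Prime)
    (hℓp : ¬ ℓ ∣ 2 * p) (hℓd : ¬ ℓ ∣ d) (P : Ideal (𝓞 (sqrtField p d))) [P.IsPrime]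
    (hP : (ℓ : 𝓞 (sqrtField p d)) ∈ P) : Nat.card (P.inertia Gal(sqrtField p d/ℚ)) ≤ 1 := by
  obtain ⟨x, hx, hx2⟩ := exists_integer_eq_sqrt (sqrt_mem_sqrtField_left p d)
  obtain ⟨y, hy, hy2⟩ := exists_integer_eq_sqrt (sqrt_mem_sqrtField_right p d)
  have : Subsingleton (P.inertia Gal(sqrtField p d/ℚ)) := by
    refine ⟨fun ⟨σ, hσ⟩ ⟨τ, hτ⟩ => Subtype.ext (gal_eq_of_smul_eq hx hy ?_ ?_)⟩
    · rw [smul_eq_self_of_mem_inertia hℓ hP hℓp hx2 hσ,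
        smul_eq_self_of_mem_inertia hℓ hP hℓp hx2 hτ]
    · rw [smul_eq_self_of_mem_inertia_of_one_mod_four hℓ hP hd hℓd hy2 hσ,
        smul_eq_self_of_mem_inertia_of_one_mod_four hℓ hP hd hℓd hy2 hτ]
  exact Finite.card_le_one_iff_subsingleton.2 this

theorem isPolyaField_sqrtField {p d : ℕ} (hp : p.Prime) (hd : d % 4 = 1)
    (hcop : (2 * p).Coprime d)
    (h2 : AssocSq (𝓞 (sqrtField p d)) 2)
    (h : ∀ ℓ : ℕ, ℓ.Prime → ℓ ∣ d → AssocSq (𝓞 (sqrtField p d)) ℓ) :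
    IsPolyaField (sqrtField p d) := by
  intro ℓ f hℓ _
  refine ostrowskiIdeal_isPrincipal hℓ (fun P _ hP => card_inertia_le_two hd hcop hℓ P hP) ?_
  by_cases hℓd : ℓ ∣ d
  · exact Or.inl (by simpa [AssocSq] using h ℓ hℓ hℓd)
  by_cases hℓp : ℓ ∣ 2 * p
  · left
    rcases hℓ.dvd_mul.1 hℓp with h' | h'
    · obtain rfl := (Nat.prime_dvd_prime_iff_eq hℓ Nat.prime_two).1 h'
      simpa [AssocSq] using h2
    · obtain rfl := (Nat.prime_dvd_prime_iff_eq hℓ hp).1 h'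
      obtain ⟨x, -, hx⟩ := exists_integer_eq_sqrt (sqrt_mem_sqrtField_left ℓ d)
      exact ⟨x, by rw [hx]⟩
  · exact Or.inr fun P _ hP => card_inertia_le_one hd hℓ hℓp hℓd P hP

end sqrtField

/-- `legendreSym s a` is the Legendre symbol `(a/s)`. -/
theorem theorem1p1 (p q r s : ℕ)
    [Fact p.Prime] [Fact q.Prime] [Fact r.Prime] [Fact s.Prime]
    (hp : p ≡ 3 [MOD 4]) (hq : q ≡ 3 [MOD 4]) (hr : r ≡ 3 [MOD 4])
    (hqrs : q * r * s ≡ 1 [MOD 4])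
    (hs : ¬ (legendreSym s q = 1 ∧ legendreSym s r = 1))
    (hps : legendreSym s p ≠ legendreSym s 2) (h2s : legendreSym s 2 = -1)
    (hqrp : legendreSym p (q * r) = -1) :
    (legendreSym q (p * r) = -1 → IsPolyaField (sqrtField p (q * r * s))) ∧
      (legendreSym s q = -1 ∧ legendreSym s r = -1 →
        IsPolyaField (sqrtField p (q * r * s))) := by
  suffices H : legendreSym q (p * r) = -1 ∨ (legendreSym s q = -1 ∧ legendreSym s r = -1) →
      IsPolyaField (sqrtField p (q * r * s)) from ⟨fun h => H (Or.inl h), fun h => H (Or.inr h)⟩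
  intro hcase
  have hp4 : p % 4 = 3 := hp
  have hq4 : q % 4 = 3 := hq
  have hr4 : r % 4 = 3 := hr
  have hqrs4 : q * r * s % 4 = 1 := hqrs
  have hs4 : s % 4 = 1 := by
    rw [Nat.mul_mod, Nat.mul_mod q r, hq4, hr4] at hqrs4
    omega
  have hps1 : legendreSym s p = 1 :=
    (legendreSym_prime_eq_one_or_neg_one (show s ≠ p by omega)).resolve_right (h2s ▸ hps)
  have hpq : p ≠ q := by
    rintro rfl
    rw [legendreSym.mul, (legendreSym.eq_zero_iff p p).2 (by simp)] at hqrp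
    omega
  have hpr : p ≠ r := by
    rintro rfl
    rw [legendreSym.mul, (legendreSym.eq_zero_iff p p).2 (by simp)] at hqrp
    omega
  have hpP : p.Prime := Fact.out
  have hqP : q.Prime := Fact.out
  have hrP : r.Prime := Fact.out
  have hsP : s.Prime := Fact.out
  have hcop : (2 * p).Coprime (q * r * s) := by
    refine Nat.Coprime.mul_left ?_ ?_
    · rw [Nat.coprime_two_left, Nat.odd_iff]
      omega
    · exact ((((Nat.coprime_primes hpP hqP).2 hpq).mul_right
        ((Nat.coprime_primes hpP hrP).2 hpr))).mul_right
        ((Nat.coprime_primes hpP hsP).2 (by omega))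
  obtain ⟨x, -, hx⟩ := exists_integer_eq_sqrt (sqrt_mem_sqrtField_left p (q * r * s))
  obtain ⟨y, -, hy⟩ := exists_integer_eq_sqrt (sqrt_mem_sqrtField_right p (q * r * s))
  obtain ⟨h2, h_q, h_r, h_s⟩ :=
    assocSq_two_and_primes hp4 hq4 hr4 hs4 hs hps1 h2s hqrp hcase hx hy
  refine isPolyaField_sqrtField hpP hqrs hcop h2 fun ℓ hℓ hdvd => ?_
  rcases hℓ.dvd_mul.1 hdvd with hdvd | hdvd
  · rcases hℓ.dvd_mul.1 hdvd with hdvd | hdvd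
    · rwa [(Nat.prime_dvd_prime_iff_eq hℓ hqP).1 hdvd]
    · rwa [(Nat.prime_dvd_prime_iff_eq hℓ hrP).1 hdvd]
  · rwa [(Nat.prime_dvd_prime_iff_eq hℓ hsP).1 hdvd]
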